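/- Let $k$ be a field; all algebras (associative, unital), coalgebras, linear maps and tensor products are over $k$. **Crossed products.** Let $A$ be an algebra with multiplication $\mu$, $V$ a vector space with a distinguished element $1_V$, and let $R:V\otimes A\to A\otimes V$, $\sigma:V\otimes V\to A\otimes V$ be linear maps. We say that $A\otimes_{R,\sigma}V$ is a crossed product if, for all $a\in A$, $v\in V$, $R(1_V\otimes a)=a\otimes 1_V$, $R(v\otimes 1_A)=1_A\otimes v$, $\sigma(1_V\otimes v)=\sigma(v\otimes 1_V)=1_A\otimes v$, and $$R(\mathrm{id}\otimes\mu)=(\mu\otimes\mathrm{id})(\mathrm{id}\otimes R)(R\otimes\mathrm{id}),$$ $$(\mu\otimes\mathrm{id})(\mathrm{id}\otimes\sigma)(R\otimes\mathrm{id})(\mathrm{id}\otimes\sigma)=(\mu\otimes\mathrm{id})(\mathrm{id}\otimes\sigma)(\sigma\otimes\mathrm{id}),$$ $$(\mu\otimes\mathrm{id})(\mathrm{id}\otimes\sigma)(R\otimes\mathrm{id})(\mathrm{id}\otimes R)=(\mu\otimes\mathrm{id})(\mathrm{id}\otimes R)(\sigma\otimes\mathrm{id}).$$ Then $A\otimes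 V$ with multiplication $(\mu_2\otimes\mathrm{id})(\mathrm{id}\otimes\mathrm{id}\otimes\sigma)(\mathrm{id}\otimes R\otimes\mathrm{id})$, $\mu_2=\mu(\mathrm{id}\otimes\mu)$, and unit $1_A\otimes 1_V$ is an algebra, denoted $A\otimes_{R,\sigma}V$. For linear maps $\theta,\gamma:V\to A\otimes V$, put $$R'=(\mu_2\otimes \mathrm{id})(\mathrm{id}\otimes\mathrm{id}\otimes\gamma)(\mathrm{id}\otimes R)(\theta\otimes\mathrm{id}),$$ $$\sigma'=(\mu\otimes\mathrm{id})(\mathrm{id}\otimes\gamma)(\mu_2\otimes\mathrm{id})(\mathrm{id}\otimes\mathrm{id}\otimes\sigma)(\mathrm{id}\otimes R\otimes\mathrm{id})(\theta\otimes\theta).$$ The *twisting conditions* for $\theta,\gamma$ are: $\theta(1_V)=\gamma(1_V)=1_A\otimes 1_V$; $(\mu\otimes\mathrm{id})(\mathrm{id}\otimes\gamma)\theta(v)=1_A\otimes v=(\mu\otimes\mathrm{id})(\mathrm{id}\otimes\theta)\gamma(v)$ for all $v\in V$; and $$(\mu\otimes\mathrm{id})(\mu\otimes\sigma')(\mathrm{id}\otimes\gamma\otimes\mathrm{id})(R\otimes\mathrm{id})(\mathrm{id}\otimes\gamma)=(\mu\otimes\mathrm{id})(\mathrm{id}\otimes\gamma)\sigma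 .$$ **Crossed products by a coalgebra.** Entwining data $(P,C,\Psi,e,\Psi^C)$ consist of an algebra $P$, a coalgebra $C$ with a group-like element $e$, and linear maps $\Psi:C\otimes P\to P\otimes C$, $\Psi^C:C\otimes C\to C\otimes C$ with $\Psi(\mathrm{id}\otimes\mu)=(\mu\otimes\mathrm{id})\Psi_{23}\Psi_{12}$, $\Psi(c\otimes 1)=1\otimes c$, $(\mathrm{id}\otimes\Delta)\Psi=\Psi_{12}\Psi_{23}(\Delta\otimes\mathrm{id})$, $(\mathrm{id}\otimes\varepsilon)\Psi=\varepsilon\otimes\mathrm{id}$, $(\mathrm{id}\otimes\Delta)\Psi^C=\Psi^C_{12}\Psi^C_{23}(\Delta\otimes\mathrm{id})$, $(\mathrm{id}\otimes\varepsilon)\Psi^C=\varepsilon\otimes\mathrm{id}$ and $\Psi^C(e\otimes c)=\Delta(c)$. Write $\Psi(c\otimes u)=u_\alpha\otimes c^\alpha$ and $\Psi^C(c\otimes d)=d_\beta\otimes c^\beta$ (summation understood). Let $A=\{u\in P:\Psi(e\otimes u)=u\otimes e\}$, a subalgebra of $P$. For linear maps $F:C\otimes P\to P$ and $f:C\otimes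 C\to A$ put $$R_F=(F\otimes\mathrm{id})(\mathrm{id}\otimes\Psi)(\Delta\otimes\mathrm{id}_A),\qquad \sigma_f=(f\otimes\mathrm{id})(\mathrm{id}\otimes\Psi^C)(\Delta\otimes\mathrm{id}).$$ We say that $A\rtimes_{F,f}C$ is a crossed product by a coalgebra if $R_F$ maps $C\otimes A$ into $A\otimes C$ and $A\otimes_{R_F,\sigma_f}C$ is a crossed product, with distinguished element $e$ of $C$; then $A\rtimes_{F,f}C$ denotes this algebra. **Theorem.** Let $(P,C,\Psi,e,\Psi^C)$ be entwining data and let $A\rtimes_{F,f}C$ be a crossed product by a coalgebra. Let $\nu:C\to A$ be a convolution invertible linear map, with convolution inverse $\nu^{-1}$, such that $\nu(e)=1$ and $$\Psi^C_{23}\circ\Psi_{12}\circ(\mathrm{id}_C\otimes\nu\otimes\mathrm{id}_C)\circ(\mathrm{id}_C\otimes\Delta)=(\nu\otimes\mathrm{id}_C\otimes\mathrm{id}_C)\circ(\Delta\otimes\mathrm{id}_C)\circ\Psi^C .$$ Put $\theta(c)=\nu(c_1)\otimes c_2$, $\gamma(c)=\nu^{-1}(c_1)\otimes c_2$, and define $F_\nu:C\otimes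 P\to P$ and $f_\nu:C\otimes C\to A$ by $$F_\nu(c\otimes u)=\nu(c_1)\,F(c_2\otimes u_\alpha)\,\nu^{-1}(c_3{}^{\alpha}),$$ $$f_\nu(c\otimes d)=\nu(c_1)\,F(c_2\otimes\nu(d_1)_\alpha)\,f\big((c_3{}^{\alpha})_1\otimes (d_2)_\beta\big)\,\nu^{-1}\big(((c_3{}^{\alpha})_2)^{\beta}\big).$$ Then: 1. $\theta$ and $\gamma$ satisfy the twisting conditions for $A\otimes_{R_F,\sigma_f}C$, and the resulting $A\otimes_{R_F',\sigma_f'}C$ is a crossed product; 2. $A\rtimes_{F_\nu,f_\nu}C$ is a crossed product by a coalgebra, and $R_F'=R_{F_\nu}$, $\sigma_f'=\sigma_{f_\nu}$; 3. $a\otimes c\mapsto a\,\nu(c_1)\otimes c_2$ is an isomorphism of algebras $A\rtimes_{F_\nu,f_\nu}C\to A\rtimes_{F,f}C$. -/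

import Mathlib

open scoped TensorProduct

noncomputable section

namespace CrossedProd

/-! ### General crossed products `A ⊗_{R,σ} V` -/

section General

variable {k A V : Type*} [Field k] [Ring A] [Algebra k A] [AddCommGroup V] [Module k V]

variable (k A V) in
/-- The map `μ ⊗ id_V : A ⊗ A ⊗ V → A ⊗ V`. -/
def mulId : A ⊗[k] (A ⊗[k] V) →ₗ[k] A ⊗[k] V :=
  (LinearMap.mul' k A).rTensor V ∘ₗ (TensorProduct.assoc k A A V).symm.toLinearMap

/-- For `τ : V ⊗ W → A ⊗ V`, the map
`(μ ⊗ id_V) ∘ (id_A ⊗ τ) : A ⊗ V ⊗ W → A ⊗ V`. It is used for `τ = σ`, `W = V`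
and for `τ = R`, `W = A`. -/
def extLeft {W : Type*} [AddCommGroup W] [Module k W] (τ : V ⊗[k] W →ₗ[k] A ⊗[k] V) :
    (A ⊗[k] V) ⊗[k] W →ₗ[k] A ⊗[k] V :=
  mulId k A V ∘ₗ τ.lTensor A ∘ₗ (TensorProduct.assoc k A V W).toLinearMap

/-- For `g : V → A ⊗ V`, the map `(μ ⊗ id_V) ∘ (id_A ⊗ g) : A ⊗ V → A ⊗ V`. -/
def extOne (g : V →ₗ[k] A ⊗[k] V) : A ⊗[k] V →ₗ[k] A ⊗[k] V :=
  mulId k A V ∘ₗ g.lTensor A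

/-- The conditions on `R : V ⊗ A → A ⊗ V`, `σ : V ⊗ V → A ⊗ V` and the distinguished element
`one = 1_V` of `V` under which `A ⊗_{R,σ} V` is a crossed product. -/
structure IsCrossed (one : V) (R : V ⊗[k] A →ₗ[k] A ⊗[k] V)
    (σ : V ⊗[k] V →ₗ[k] A ⊗[k] V) : Prop where
  R_one_left : ∀ a : A, R (one ⊗ₜ a) = a ⊗ₜ one
  R_one_right : ∀ v : V, R (v ⊗ₜ 1) = 1 ⊗ₜ v
  σ_one_left : ∀ v : V, σ (one ⊗ₜ v) = 1 ⊗ₜ v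
  σ_one_right : ∀ v : V, σ (v ⊗ₜ one) = 1 ⊗ₜ v
  /-- `R ∘ (id ⊗ μ) = (μ ⊗ id) ∘ (id ⊗ R) ∘ (R ⊗ id)` -/
  R_mul : R ∘ₗ (LinearMap.mul' k A).lTensor V =
    extLeft R ∘ₗ R.rTensor A ∘ₗ (TensorProduct.assoc k V A A).symm.toLinearMap
  /-- `(μ ⊗ id) ∘ (id ⊗ σ) ∘ (R ⊗ id) ∘ (id ⊗ σ) = (μ ⊗ id) ∘ (id ⊗ σ) ∘ (σ ⊗ id)` -/
  cocycle : extLeft σ ∘ₗ R.rTensor V ∘ₗ (TensorProduct.assoc k V A V).symm.toLinearMap ∘ₗ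
      σ.lTensor V =
    extLeft σ ∘ₗ σ.rTensor V ∘ₗ (TensorProduct.assoc k V V V).symm.toLinearMap
  /-- `(μ ⊗ id) ∘ (id ⊗ σ) ∘ (R ⊗ id) ∘ (id ⊗ R) = (μ ⊗ id) ∘ (id ⊗ R) ∘ (σ ⊗ id)` -/
  twisted : extLeft σ ∘ₗ R.rTensor V ∘ₗ (TensorProduct.assoc k V A V).symm.toLinearMap ∘ₗ
      R.lTensor V =
    extLeft R ∘ₗ σ.rTensor A ∘ₗ (TensorProduct.assoc k V V A).symm.toLinearMap

/-- The multiplication `(μ₂ ⊗ id_V) ∘ (id_A ⊗ id_A ⊗ σ) ∘ (id_A ⊗ R ⊗ id_V)` on `A ⊗ V`, where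
`μ₂ = μ ∘ (id_A ⊗ μ)`. -/
def crossedMul (R : V ⊗[k] A →ₗ[k] A ⊗[k] V) (σ : V ⊗[k] V →ₗ[k] A ⊗[k] V) :
    (A ⊗[k] V) ⊗[k] (A ⊗[k] V) →ₗ[k] A ⊗[k] V :=
  mulId k A V ∘ₗ
    (extLeft σ ∘ₗ R.rTensor V ∘ₗ (TensorProduct.assoc k V A V).symm.toLinearMap).lTensor A ∘ₗ
    (TensorProduct.assoc k A V (A ⊗[k] V)).toLinearMap

/-! #### The algebra structure -/

@[simp] lemma mulId_tmul (a b : A) (v : V) :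
    mulId k A V (a ⊗ₜ (b ⊗ₜ v)) = (a * b) ⊗ₜ v := by
  simp [mulId]

lemma mulId_one (x : A ⊗[k] V) : mulId k A V (1 ⊗ₜ x) = x := by
  induction x with
  | zero => simp
  | tmul a v => simp
  | add x y hx hy => rw [TensorProduct.tmul_add, map_add, hx, hy]

lemma mulId_mul (a b : A) (x : A ⊗[k] V) :
    mulId k A V ((a * b) ⊗ₜ x) = mulId k A V (a ⊗ₜ mulId k A V (b ⊗ₜ x)) := by
  induction x with
  | zero => simp
  | tmul c v => simp [mul_assoc]
  | add x y hx hy => simp only [TensorProduct.tmul_add, map_add, hx, hy]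

@[simp] lemma ext_tmul {W : Type*} [AddCommGroup W] [Module k W]
    (τ : V ⊗[k] W →ₗ[k] A ⊗[k] V) (a : A) (v : V) (w : W) :
    extLeft τ ((a ⊗ₜ v) ⊗ₜ w) = mulId k A V (a ⊗ₜ τ (v ⊗ₜ w)) := by
  simp [extLeft]

lemma ext_mulId {W : Type*} [AddCommGroup W] [Module k W]
    (τ : V ⊗[k] W →ₗ[k] A ⊗[k] V) (a : A) (x : A ⊗[k] V) (w : W) :
    extLeft τ (mulId k A V (a ⊗ₜ x) ⊗ₜ w) = mulId k A V (a ⊗ₜ extLeft τ (x ⊗ₜ w)) := by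
  induction x with
  | zero => simp
  | tmul b v => simp [mulId_mul]
  | add x y hx hy => simp only [TensorProduct.tmul_add, TensorProduct.add_tmul, map_add, hx, hy]

lemma crossedMul_tmul (R : V ⊗[k] A →ₗ[k] A ⊗[k] V) (σ : V ⊗[k] V →ₗ[k] A ⊗[k] V)
    (a b : A) (v w : V) :
    crossedMul R σ ((a ⊗ₜ v) ⊗ₜ (b ⊗ₜ w)) =
      mulId k A V (a ⊗ₜ extLeft σ (R (v ⊗ₜ b) ⊗ₜ w)) := by
  simp [crossedMul]

lemma crossedMul_mulId (R : V ⊗[k] A →ₗ[k] A ⊗[k] V) (σ : V ⊗[k] V →ₗ[k] A ⊗[k] V)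
    (a : A) (x y : A ⊗[k] V) :
    crossedMul R σ (mulId k A V (a ⊗ₜ x) ⊗ₜ y) =
      mulId k A V (a ⊗ₜ crossedMul R σ (x ⊗ₜ y)) := by
  induction x with
  | zero => simp
  | add x x' hx hx' => simp only [TensorProduct.tmul_add, TensorProduct.add_tmul, map_add, hx, hx']
  | tmul b v =>
    induction y with
    | zero => simp
    | add y y' hy hy' => simp only [TensorProduct.tmul_add, map_add, hy, hy']
    | tmul c w => simp [crossedMul_tmul, mulId_mul]

namespace IsCrossed

variable {one : V} {R : V ⊗[k] A →ₗ[k] A ⊗[k] V} {σ : V ⊗[k] V →ₗ[k] A ⊗[k] V}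

lemma R_mul_apply (h : IsCrossed one R σ) (v : V) (a b : A) :
    R (v ⊗ₜ (a * b)) = extLeft R (R (v ⊗ₜ a) ⊗ₜ b) := by
  simpa using LinearMap.congr_fun h.R_mul (v ⊗ₜ (a ⊗ₜ b))

/-- In `A ⊗_{R,σ} V` one has `x * (b y) = (x ◁ b) * y`, where `x ◁ b` is obtained from `R`. -/
lemma crossedMul_mulId_right (h : IsCrossed one R σ) (x y : A ⊗[k] V) (b : A) :
    crossedMul R σ (x ⊗ₜ mulId k A V (b ⊗ₜ y)) =
      crossedMul R σ (extLeft R (x ⊗ₜ b) ⊗ₜ y) := by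
  induction x with
  | zero => simp
  | add x x' hx hx' => simp only [TensorProduct.add_tmul, map_add, hx, hx']
  | tmul a v =>
    induction y with
    | zero => simp
    | add y y' hy hy' => simp only [TensorProduct.tmul_add, map_add, hy, hy']
    | tmul c w =>
      rw [mulId_tmul, crossedMul_tmul, h.R_mul_apply, ext_tmul, crossedMul_mulId]
      generalize R (v ⊗ₜ b) = z
      congr 2
      induction z with
      | zero => simp
      | add z z' hz hz' => simp only [TensorProduct.add_tmul, map_add, hz, hz']
      | tmul d u => simp [crossedMul_tmul, ext_mulId]

lemma crossedMul_one_tmul (h : IsCrossed one R σ) (x : A ⊗[k] V) (w : V) :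
    crossedMul R σ (x ⊗ₜ (1 ⊗ₜ w)) = extLeft σ (x ⊗ₜ w) := by
  induction x with
  | zero => simp
  | add x x' hx hx' => simp only [TensorProduct.add_tmul, map_add, hx, hx']
  | tmul a v => simp [crossedMul_tmul, h.R_one_right, mulId_one]

lemma crossedMul_ext (h : IsCrossed one R σ) (x z : A ⊗[k] V) (u : V) :
    crossedMul R σ (x ⊗ₜ extLeft σ (z ⊗ₜ u)) = extLeft σ (crossedMul R σ (x ⊗ₜ z) ⊗ₜ u) := by
  have key : ∀ (v w u : V),
      crossedMul R σ ((1 ⊗ₜ v) ⊗ₜ σ (w ⊗ₜ u)) = extLeft σ (σ (v ⊗ₜ w) ⊗ₜ u) := by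
    intro v w u
    have := LinearMap.congr_fun h.cocycle (v ⊗ₜ (w ⊗ₜ u))
    simpa [crossedMul, mulId_one] using this
  induction z with
  | zero => simp
  | add z z' hz hz' => simp only [TensorProduct.add_tmul, TensorProduct.tmul_add, map_add, hz, hz']
  | tmul c w =>
    rw [ext_tmul, h.crossedMul_mulId_right]
    have : crossedMul R σ (x ⊗ₜ[k] (c ⊗ₜ[k] w)) =
        crossedMul R σ (extLeft R (x ⊗ₜ c) ⊗ₜ (1 ⊗ₜ w)) := by
      rw [← h.crossedMul_mulId_right, mulId_tmul, mul_one]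
    rw [this, h.crossedMul_one_tmul]
    generalize extLeft R (x ⊗ₜ c) = y
    induction y with
    | zero => simp
    | add y y' hy hy' => simp only [TensorProduct.add_tmul, map_add, hy, hy']
    | tmul d v =>
      have h1 : (d ⊗ₜ[k] v : A ⊗[k] V) = mulId k A V (d ⊗ₜ (1 ⊗ₜ v)) := by simp
      rw [ext_tmul, ext_mulId, h1, crossedMul_mulId, key]

lemma ext_R_crossedMul (h : IsCrossed one R σ) (v w : V) (c : A) :
    extLeft R (σ (v ⊗ₜ w) ⊗ₜ c) = crossedMul R σ ((1 ⊗ₜ v) ⊗ₜ R (w ⊗ₜ c)) := by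
  have := LinearMap.congr_fun h.twisted (v ⊗ₜ (w ⊗ₜ c))
  simpa [crossedMul, mulId_one] using this.symm

lemma mul_assoc' (h : IsCrossed one R σ) (x y z : A ⊗[k] V) :
    crossedMul R σ (crossedMul R σ (x ⊗ₜ y) ⊗ₜ z) =
      crossedMul R σ (x ⊗ₜ crossedMul R σ (y ⊗ₜ z)) := by
  have key : ∀ (p : A ⊗[k] V) (w u : V) (c : A),
      crossedMul R σ (extLeft σ (p ⊗ₜ w) ⊗ₜ (c ⊗ₜ u)) =
        crossedMul R σ (p ⊗ₜ extLeft σ (R (w ⊗ₜ c) ⊗ₜ u)) := by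
    intro p w u c
    induction p with
    | zero => simp
    | add p p' hp hp' => simp only [TensorProduct.add_tmul, map_add, hp, hp']
    | tmul d v =>
      have h1 : (d ⊗ₜ[k] v : A ⊗[k] V) = mulId k A V (d ⊗ₜ (1 ⊗ₜ v)) := by simp
      have h2 : (c ⊗ₜ[k] u : A ⊗[k] V) = mulId k A V (c ⊗ₜ (1 ⊗ₜ u)) := by simp
      rw [ext_tmul, crossedMul_mulId, h1, crossedMul_mulId, h2, h.crossedMul_mulId_right,
        h.crossedMul_one_tmul, h.ext_R_crossedMul, h.crossedMul_ext]
  induction y with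
  | zero => simp
  | add y y' hy hy' => simp only [TensorProduct.add_tmul, TensorProduct.tmul_add, map_add, hy, hy']
  | tmul b w =>
    induction z with
    | zero => simp
    | add z z' hz hz' => simp only [TensorProduct.tmul_add, map_add, hz, hz']
    | tmul c u =>
      have h1 : (b ⊗ₜ[k] w : A ⊗[k] V) = mulId k A V (b ⊗ₜ (1 ⊗ₜ w)) := by simp
      rw [crossedMul_tmul, h.crossedMul_mulId_right, h1, h.crossedMul_mulId_right,
        h.crossedMul_one_tmul, key]

lemma one_mul' (h : IsCrossed one R σ) (x : A ⊗[k] V) :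
    crossedMul R σ ((1 ⊗ₜ one) ⊗ₜ x) = x := by
  induction x with
  | zero => simp
  | add x y hx hy => simp only [TensorProduct.tmul_add, map_add, hx, hy]
  | tmul a v => simp [crossedMul_tmul, h.R_one_left, h.σ_one_left]

lemma mul_one' (h : IsCrossed one R σ) (x : A ⊗[k] V) :
    crossedMul R σ (x ⊗ₜ (1 ⊗ₜ one)) = x := by
  induction x with
  | zero => simp
  | add x y hx hy => simp only [TensorProduct.add_tmul, map_add, hx, hy]
  | tmul a v => simp [crossedMul_tmul, h.R_one_right, h.σ_one_right]

end IsCrossed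

/-- The crossed product `A ⊗_{R,σ} V`: the vector space `A ⊗ V`, with the multiplication
`crossedMul R σ` and the unit `1_A ⊗ 1_V`. -/
def CrossedProduct {one : V} {R : V ⊗[k] A →ₗ[k] A ⊗[k] V} {σ : V ⊗[k] V →ₗ[k] A ⊗[k] V}
    (_ : IsCrossed one R σ) : Type _ :=
  A ⊗[k] V

namespace CrossedProduct

variable {one : V} {R : V ⊗[k] A →ₗ[k] A ⊗[k] V} {σ : V ⊗[k] V →ₗ[k] A ⊗[k] V}

instance (h : IsCrossed one R σ) : AddCommGroup (CrossedProduct h) :=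
  inferInstanceAs (AddCommGroup (A ⊗[k] V))

instance (h : IsCrossed one R σ) : Module k (CrossedProduct h) :=
  inferInstanceAs (Module k (A ⊗[k] V))

/-- The identity map from the vector space `A ⊗ V` to `A ⊗_{R,σ} V`. -/
def of (h : IsCrossed one R σ) : A ⊗[k] V ≃ₗ[k] CrossedProduct h :=
  LinearEquiv.refl k (A ⊗[k] V)

instance (h : IsCrossed one R σ) : Ring (CrossedProduct h) :=
  { (inferInstance : AddCommGroup (CrossedProduct h)) with
    mul := fun x y => of h (crossedMul R σ ((of h).symm x ⊗ₜ (of h).symm y))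
    one := of h (1 ⊗ₜ one)
    mul_assoc := fun x y z => h.mul_assoc' x y z
    one_mul := fun x => h.one_mul' x
    mul_one := fun x => h.mul_one' x
    left_distrib := fun x y z =>
      (congrArg (crossedMul R σ) (TensorProduct.tmul_add (R := k) (M := A ⊗[k] V)
        (N := A ⊗[k] V) x y z)).trans (map_add (crossedMul R σ) _ _)
    right_distrib := fun x y z =>
      (congrArg (crossedMul R σ) (TensorProduct.add_tmul (R := k) (M := A ⊗[k] V)
        (N := A ⊗[k] V) x y z)).trans (map_add (crossedMul R σ) _ _)
    zero_mul := fun x =>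
      (congrArg (crossedMul R σ) (TensorProduct.zero_tmul (R := k) (A ⊗[k] V)
        (n := (x : A ⊗[k] V)))).trans (map_zero (crossedMul R σ))
    mul_zero := fun x =>
      (congrArg (crossedMul R σ) (TensorProduct.tmul_zero (R := k) (A ⊗[k] V)
        (m := (x : A ⊗[k] V)))).trans (map_zero (crossedMul R σ)) }

instance (h : IsCrossed one R σ) : Algebra k (CrossedProduct h) :=
  Algebra.ofModule
    (fun r x y =>
      (congrArg (crossedMul R σ) (TensorProduct.smul_tmul' (R := k) (M := A ⊗[k] V)
        (N := A ⊗[k] V) r x y).symm).trans (map_smul (crossedMul R σ) r _))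
    (fun r x y =>
      (congrArg (crossedMul R σ) (TensorProduct.tmul_smul (R := k) (M := A ⊗[k] V)
        (N := A ⊗[k] V) r x y)).trans (map_smul (crossedMul R σ) r _))

end CrossedProduct

/-! #### The data of the invariance under twisting theorem -/

/-- `R' = (μ₂ ⊗ id_V) ∘ (id_A ⊗ id_A ⊗ γ) ∘ (id_A ⊗ R) ∘ (θ ⊗ id_A)`. -/
def twistR (R : V ⊗[k] A →ₗ[k] A ⊗[k] V) (θ γ : V →ₗ[k] A ⊗[k] V) :
    V ⊗[k] A →ₗ[k] A ⊗[k] V :=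
  mulId k A V ∘ₗ (extOne γ).lTensor A ∘ₗ R.lTensor A ∘ₗ
    (TensorProduct.assoc k A V A).toLinearMap ∘ₗ θ.rTensor A

/-- `σ' = (μ ⊗ id_V) ∘ (id_A ⊗ γ) ∘ (μ₂ ⊗ id_V) ∘ (id_A ⊗ id_A ⊗ σ) ∘ (id_A ⊗ R ⊗ id_V)
  ∘ (θ ⊗ θ)`. -/
def twistSigma (R : V ⊗[k] A →ₗ[k] A ⊗[k] V) (σ : V ⊗[k] V →ₗ[k] A ⊗[k] V)
    (θ γ : V →ₗ[k] A ⊗[k] V) : V ⊗[k] V →ₗ[k] A ⊗[k] V :=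
  extOne γ ∘ₗ crossedMul R σ ∘ₗ TensorProduct.map θ θ

/-- The hypotheses on `θ` and `γ` in the invariance under twisting theorem for the crossed
product `A ⊗_{R,σ} V`. -/
structure TwistConditions (one : V) (R : V ⊗[k] A →ₗ[k] A ⊗[k] V)
    (σ : V ⊗[k] V →ₗ[k] A ⊗[k] V) (θ γ : V →ₗ[k] A ⊗[k] V) : Prop where
  θ_one : θ one = 1 ⊗ₜ one
  γ_one : γ one = 1 ⊗ₜ one
  /-- `v_{<-1>} v_{<0>{-1}} ⊗ v_{<0>{0}} = 1 ⊗ v` -/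
  γ_θ : ∀ v : V, extOne γ (θ v) = 1 ⊗ₜ v
  /-- `v_{{-1}} v_{{0}<-1>} ⊗ v_{{0}<0>} = 1 ⊗ v` -/
  θ_γ : ∀ v : V, extOne θ (γ v) = 1 ⊗ₜ v
  /-- `(μ ⊗ id) ∘ (μ ⊗ σ') ∘ (id ⊗ γ ⊗ id) ∘ (R ⊗ id) ∘ (id ⊗ γ) = (μ ⊗ id) ∘ (id ⊗ γ) ∘ σ` -/
  γ_σ : mulId k A V ∘ₗ
      TensorProduct.map (LinearMap.mul' k A) (twistSigma R σ θ γ) ∘ₗ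
      (TensorProduct.assoc k (A ⊗[k] A) V V).toLinearMap ∘ₗ
      (TensorProduct.assoc k A A V).symm.toLinearMap.rTensor V ∘ₗ
      (γ.lTensor A).rTensor V ∘ₗ R.rTensor V ∘ₗ
      (TensorProduct.assoc k V A V).symm.toLinearMap ∘ₗ γ.lTensor V =
    extOne γ ∘ₗ σ

end General

/-! ### Entwining data and crossed products by a coalgebra -/

open Coalgebra

/-- Entwining data `(P, C, Ψ, e, Ψ^C)`: an entwining structure `Ψ : C ⊗ P → P ⊗ C` between an
algebra `P` and a coalgebra `C`, a group-like element `e` of `C` and a map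
`Ψ^C : C ⊗ C → C ⊗ C` that is compatible with the coalgebra structure as `Ψ` is and satisfies
`Ψ^C (e ⊗ c) = Δ c`. -/
structure EntwiningData (k P C : Type*) [Field k] [Ring P] [Algebra k P] [AddCommGroup C]
    [Module k C] [Coalgebra k C] where
  /-- the entwining map `Ψ` -/
  Ψ : C ⊗[k] P →ₗ[k] P ⊗[k] C
  /-- the group-like element -/
  e : C
  /-- the map `Ψ^C` -/
  ΨC : C ⊗[k] C →ₗ[k] C ⊗[k] C
  /-- `Ψ ∘ (id ⊗ μ) = (μ ⊗ id) ∘ Ψ₂₃ ∘ Ψ₁₂` -/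
  Ψ_mul : Ψ ∘ₗ (LinearMap.mul' k P).lTensor C =
    (LinearMap.mul' k P).rTensor C ∘ₗ (TensorProduct.assoc k P P C).symm.toLinearMap ∘ₗ
      Ψ.lTensor P ∘ₗ (TensorProduct.assoc k P C P).toLinearMap ∘ₗ Ψ.rTensor P ∘ₗ
      (TensorProduct.assoc k C P P).symm.toLinearMap
  Ψ_one : ∀ c : C, Ψ (c ⊗ₜ 1) = 1 ⊗ₜ c
  /-- `(id ⊗ Δ) ∘ Ψ = Ψ₁₂ ∘ Ψ₂₃ ∘ (Δ ⊗ id)` -/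
  Ψ_comul : (comul (R := k) (A := C)).lTensor P ∘ₗ Ψ =
    (TensorProduct.assoc k P C C).toLinearMap ∘ₗ Ψ.rTensor C ∘ₗ
      (TensorProduct.assoc k C P C).symm.toLinearMap ∘ₗ Ψ.lTensor C ∘ₗ
      (TensorProduct.assoc k C C P).toLinearMap ∘ₗ (comul (R := k) (A := C)).rTensor P
  /-- `(id ⊗ ε) ∘ Ψ = ε ⊗ id` -/
  Ψ_counit : (TensorProduct.rid k P).toLinearMap ∘ₗ (counit (R := k) (A := C)).lTensor P ∘ₗ Ψ =
    (TensorProduct.lid k P).toLinearMap ∘ₗ (counit (R := k) (A := C)).rTensor P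
  groupLike : IsGroupLikeElem k e
  /-- `(id ⊗ Δ) ∘ Ψ^C = Ψ^C₁₂ ∘ Ψ^C₂₃ ∘ (Δ ⊗ id)` -/
  ΨC_comul : (comul (R := k) (A := C)).lTensor C ∘ₗ ΨC =
    (TensorProduct.assoc k C C C).toLinearMap ∘ₗ ΨC.rTensor C ∘ₗ
      (TensorProduct.assoc k C C C).symm.toLinearMap ∘ₗ ΨC.lTensor C ∘ₗ
      (TensorProduct.assoc k C C C).toLinearMap ∘ₗ (comul (R := k) (A := C)).rTensor C
  /-- `(id ⊗ ε) ∘ Ψ^C = ε ⊗ id` -/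
  ΨC_counit : (TensorProduct.rid k C).toLinearMap ∘ₗ (counit (R := k) (A := C)).lTensor C ∘ₗ ΨC =
    (TensorProduct.lid k C).toLinearMap ∘ₗ (counit (R := k) (A := C)).rTensor C
  ΨC_e : ∀ c : C, ΨC (e ⊗ₜ c) = comul (R := k) c

namespace EntwiningData

variable {k P C : Type*} [Field k] [Ring P] [Algebra k P] [AddCommGroup C]
    [Module k C] [Coalgebra k C] (E : EntwiningData k P C)

lemma Ψ_mul_apply (c : C) (a b : P) :
    E.Ψ (c ⊗ₜ (a * b)) = (LinearMap.mul' k P).rTensor C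
      ((TensorProduct.assoc k P P C).symm (E.Ψ.lTensor P
        (TensorProduct.assoc k P C P (E.Ψ (c ⊗ₜ a) ⊗ₜ b)))) := by
  simpa using LinearMap.congr_fun E.Ψ_mul (c ⊗ₜ (a ⊗ₜ b))

/-- The subalgebra `A = P_e^{co C} = {u ∈ P | Ψ (e ⊗ u) = u ⊗ e}` of coinvariants. -/
def coinv : Subalgebra k P where
  carrier := {u | E.Ψ (E.e ⊗ₜ u) = u ⊗ₜ E.e}
  mul_mem' := by
    intro a b ha hb
    simp only [Set.mem_ofPred_eq] at ha hb ⊢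
    rw [E.Ψ_mul_apply, ha]
    simp [hb]
  add_mem' := by
    intro a b ha hb
    simp only [Set.mem_ofPred_eq] at ha hb ⊢
    rw [TensorProduct.tmul_add, map_add, ha, hb, TensorProduct.add_tmul]
  algebraMap_mem' := by
    intro r
    simp only [Set.mem_ofPred_eq]
    rw [Algebra.algebraMap_eq_smul_one, TensorProduct.tmul_smul, map_smul, E.Ψ_one,
      TensorProduct.smul_tmul']

/-- The inclusion `A → P`. -/
def incl : E.coinv →ₗ[k] P := E.coinv.val.toLinearMap

/-- The inclusion `A ⊗ C → P ⊗ C`. -/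
def inclC : E.coinv ⊗[k] C →ₗ[k] P ⊗[k] C := E.incl.rTensor C

lemma inclC_injective : Function.Injective E.inclC :=
  Module.Flat.rTensor_preserves_injective_linearMap E.incl Subtype.val_injective

/-- The map `(F ⊗ id_C) ∘ (id_C ⊗ Ψ) ∘ (Δ ⊗ id_A) : C ⊗ A → P ⊗ C`. -/
def preR (F : C ⊗[k] P →ₗ[k] P) : C ⊗[k] E.coinv →ₗ[k] P ⊗[k] C :=
  F.rTensor C ∘ₗ (TensorProduct.assoc k C P C).symm.toLinearMap ∘ₗ E.Ψ.lTensor C ∘ₗ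
    (TensorProduct.assoc k C C P).toLinearMap ∘ₗ
    TensorProduct.map (comul (R := k) (A := C)) E.incl

/-- `(F ⊗ id_C) ∘ (id_C ⊗ Ψ) ∘ (Δ ⊗ id_A)` takes its values in `A ⊗ C`. -/
def MapsCoinv (F : C ⊗[k] P →ₗ[k] P) : Prop :=
  ∀ x, E.preR F x ∈ LinearMap.range E.inclC

/-- `R_F = (F ⊗ id_C) ∘ (id_C ⊗ Ψ) ∘ (Δ ⊗ id_A)`, as a map `C ⊗ A → A ⊗ C`. -/
def RF (F : C ⊗[k] P →ₗ[k] P) (hF : E.MapsCoinv F) : C ⊗[k] E.coinv →ₗ[k] E.coinv ⊗[k] C :=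
  LinearMap.codRestrictOfInjective (E.preR F) E.inclC E.inclC_injective hF

/-- `σ_f = (f ⊗ id_C) ∘ (id_C ⊗ Ψ^C) ∘ (Δ ⊗ id_C)`. -/
def sigmaF (f : C ⊗[k] C →ₗ[k] E.coinv) : C ⊗[k] C →ₗ[k] E.coinv ⊗[k] C :=
  f.rTensor C ∘ₗ (TensorProduct.assoc k C C C).symm.toLinearMap ∘ₗ E.ΨC.lTensor C ∘ₗ
    (TensorProduct.assoc k C C C).toLinearMap ∘ₗ (comul (R := k) (A := C)).rTensor C

/-- `F` and `f` define a crossed product by a coalgebra: `R_F` is a map `C ⊗ A → A ⊗ C` and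
`A ⊗_{R_F,σ_f} C` is a crossed product. -/
structure IsCoalgCrossed (F : C ⊗[k] P →ₗ[k] P) (f : C ⊗[k] C →ₗ[k] E.coinv) : Prop where
  mapsCoinv : E.MapsCoinv F
  isCrossed : IsCrossed E.e (E.RF F mapsCoinv) (E.sigmaF f)

variable {E} in
/-- The crossed product by a coalgebra `A ⋊_{F,f} C = A ⊗_{R_F,σ_f} C`. -/
abbrev CoalgCrossedProduct {F : C ⊗[k] P →ₗ[k] P} {f : C ⊗[k] C →ₗ[k] E.coinv}
    (h : E.IsCoalgCrossed F f) : Type _ :=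
  CrossedProduct h.isCrossed

/-- The map `c ↦ ν(c₁) ⊗ c₂`. -/
def coact (ν : C →ₗ[k] E.coinv) : C →ₗ[k] E.coinv ⊗[k] C :=
  ν.rTensor C ∘ₗ comul (R := k) (A := C)

/-- `Ψ^C₂₃ ∘ Ψ₁₂ ∘ (id ⊗ ν ⊗ id) ∘ (id ⊗ Δ) = (ν ⊗ id ⊗ id) ∘ (Δ ⊗ id) ∘ Ψ^C`, as maps
`C ⊗ C → P ⊗ C ⊗ C`. -/
def Compatible (ν : C →ₗ[k] E.coinv) : Prop :=
  E.ΨC.lTensor P ∘ₗ (TensorProduct.assoc k P C C).toLinearMap ∘ₗ E.Ψ.rTensor C ∘ₗ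
      (TensorProduct.assoc k C P C).symm.toLinearMap ∘ₗ
      ((E.incl ∘ₗ ν).rTensor C).lTensor C ∘ₗ (comul (R := k) (A := C)).lTensor C =
    (E.incl ∘ₗ ν).rTensor (C ⊗[k] C) ∘ₗ (TensorProduct.assoc k C C C).toLinearMap ∘ₗ
      (comul (R := k) (A := C)).rTensor C ∘ₗ E.ΨC

/-- `F_ν(c ⊗ u) = ν(c₁) F(c₂ ⊗ u_α) ν⁻¹(c₃^α)`, where `Ψ(c ⊗ u) = u_α ⊗ c^α`; the argument `ν'`
stands for the convolution inverse of `ν`. -/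
def twistF (F : C ⊗[k] P →ₗ[k] P) (ν ν' : C →ₗ[k] E.coinv) : C ⊗[k] P →ₗ[k] P :=
  LinearMap.mul' k P ∘ₗ
    TensorProduct.map (E.incl ∘ₗ ν)
      (LinearMap.mul' k P ∘ₗ TensorProduct.map F (E.incl ∘ₗ ν') ∘ₗ
        (TensorProduct.assoc k C P C).symm.toLinearMap ∘ₗ E.Ψ.lTensor C ∘ₗ
        (TensorProduct.assoc k C C P).toLinearMap ∘ₗ (comul (R := k) (A := C)).rTensor P) ∘ₗ
    (TensorProduct.assoc k C C P).toLinearMap ∘ₗ (comul (R := k) (A := C)).rTensor P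

/-- `f_ν(c ⊗ d) = ν(c₁) F(c₂ ⊗ ν(d₁)_α) f(c₃^α₁ ⊗ d₂_β) ν⁻¹(c₃^α₂^β)`, where
`Ψ(c ⊗ u) = u_α ⊗ c^α` and `Ψ^C(c ⊗ d) = d_β ⊗ c^β`. The factors in the middle are grouped as
`R_F(c₂ ⊗ ν(d₁)) = F(c₂ ⊗ ν(d₁)_α) ⊗ c₃^α` and `σ_f(x ⊗ d₂) = f(x₁ ⊗ d₂_β) ⊗ x₂^β`, which
shows that the values are in `A`. The argument `ν'` stands for the convolution inverse of `ν`. -/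
def twistCocycle (F : C ⊗[k] P →ₗ[k] P) (hF : E.MapsCoinv F) (f : C ⊗[k] C →ₗ[k] E.coinv)
    (ν ν' : C →ₗ[k] E.coinv) : C ⊗[k] C →ₗ[k] E.coinv :=
  LinearMap.mul' k E.coinv ∘ₗ
    TensorProduct.map ν
      (LinearMap.mul' k E.coinv ∘ₗ
        (LinearMap.mul' k E.coinv ∘ₗ ν'.lTensor E.coinv ∘ₗ E.sigmaF f).lTensor E.coinv ∘ₗ
        (TensorProduct.assoc k E.coinv C C).toLinearMap ∘ₗ
        (E.RF F hF).rTensor C ∘ₗ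
        (TensorProduct.assoc k C E.coinv C).symm.toLinearMap ∘ₗ
        (E.coact ν).lTensor C) ∘ₗ
    (TensorProduct.assoc k C C C).toLinearMap ∘ₗ (comul (R := k) (A := C)).rTensor C

end EntwiningData

end CrossedProd

end

/-!
The twisting conditions make `a ⊗ v ↦ a θ(v)` a linear automorphism of `A ⊗ V` with inverse
`a ⊗ v ↦ a γ(v)`. Transporting the multiplication of `A ⊗_{R,σ} V` along it gives the
multiplication built from `R'` and `σ'`, so the axioms for `R'` and `σ'` are instances of
associativity and unitality in `A ⊗_{R,σ} V`.

For a crossed product by a coalgebra, `R_F`, `σ_f`, `θ` and `γ` are colinear maps into cofree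
comodules, where `C ⊗ X` carries the coaction `c ⊗ x ↦ c₁ ⊗ T(c₂ ⊗ x)` with `T = Ψ` or
`T = Ψ^C`. Hence so are `R'` and `σ'`; for the latter, the compatibility of `ν` with `Ψ` and
`Ψ^C` says that `θ` intertwines `Ψ^C` with the composite of `Ψ` and `Ψ^C`. A colinear map into
a cofree comodule is determined by its composite with `id ⊗ ε`, and for `R'` and `σ'` these
composites are `F_ν` and `f_ν`. As `Ψ` need not preserve `A`, colinearity is formulated over
`P`, to which the constructions are extended along `A ⊆ P`.
-/

noncomputable section

namespace CrossedProd

open Coalgebra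

section Twist

variable {k A V : Type*} [Field k] [Ring A] [Algebra k A] [AddCommGroup V] [Module k V]

@[simp] lemma extOne_tmul (g : V →ₗ[k] A ⊗[k] V) (a : A) (v : V) :
    extOne g (a ⊗ₜ v) = mulId k A V (a ⊗ₜ g v) := rfl

lemma extOne_comp_mulId (g : V →ₗ[k] A ⊗[k] V) :
    extOne g ∘ₗ mulId k A V = mulId k A V ∘ₗ (extOne g).lTensor A := by
  ext a b v
  simp [mulId_mul]

lemma extOne_mulId (g : V →ₗ[k] A ⊗[k] V) (a : A) (x : A ⊗[k] V) :
    extOne g (mulId k A V (a ⊗ₜ x)) = mulId k A V (a ⊗ₜ extOne g x) :=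
  LinearMap.congr_fun (extOne_comp_mulId g) (a ⊗ₜ x)

lemma extOne_extOne {θ γ : V →ₗ[k] A ⊗[k] V} (h : ∀ v, extOne γ (θ v) = 1 ⊗ₜ v)
    (x : A ⊗[k] V) : extOne γ (extOne θ x) = x := by
  suffices extOne γ ∘ₗ extOne θ = LinearMap.id from LinearMap.congr_fun this x
  ext a v
  simp [extOne_mulId, h]

lemma extOne_injective {θ γ : V →ₗ[k] A ⊗[k] V} (h : ∀ v, extOne γ (θ v) = 1 ⊗ₜ v) :
    Function.Injective (extOne θ) :=
  Function.LeftInverse.injective (extOne_extOne h)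

lemma mulId_map_mul'_lTensor {W : Type*} [AddCommGroup W] [Module k W]
    (τ : V ⊗[k] W →ₗ[k] A ⊗[k] V) (γ : V →ₗ[k] A ⊗[k] V) :
    mulId k A V ∘ₗ TensorProduct.map (LinearMap.mul' k A) τ ∘ₗ
        (TensorProduct.assoc k (A ⊗[k] A) V W).toLinearMap ∘ₗ
        (TensorProduct.assoc k A A V).symm.toLinearMap.rTensor W ∘ₗ (γ.lTensor A).rTensor W =
      extLeft τ ∘ₗ (extOne γ).rTensor W := by
  ext a v w
  simp only [TensorProduct.AlgebraTensorModule.curry_apply, TensorProduct.curry_apply,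
    LinearMap.coe_restrictScalars, LinearMap.comp_apply, LinearMap.rTensor_tmul,
    LinearMap.lTensor_tmul, extOne_tmul, ext_mulId, LinearEquiv.coe_coe]
  induction γ v with
  | zero => simp
  | tmul b u => simp [mulId_mul]
  | add x y hx hy => simp only [TensorProduct.tmul_add, TensorProduct.add_tmul, map_add, hx, hy]

lemma crossedMul_eq (R : V ⊗[k] A →ₗ[k] A ⊗[k] V) (σ : V ⊗[k] V →ₗ[k] A ⊗[k] V) :
    crossedMul R σ = extLeft σ ∘ₗ (extLeft R).rTensor V ∘ₗ
      (TensorProduct.assoc k (A ⊗[k] V) A V).symm.toLinearMap := by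
  ext a v b w
  simp [crossedMul_tmul, ext_mulId]

lemma crossedMul_one_left (R : V ⊗[k] A →ₗ[k] A ⊗[k] V) (σ : V ⊗[k] V →ₗ[k] A ⊗[k] V)
    (v : V) (y : A ⊗[k] V) :
    crossedMul R σ ((1 ⊗ₜ v) ⊗ₜ y) =
      extLeft σ (R.rTensor V ((TensorProduct.assoc k V A V).symm (v ⊗ₜ y))) := by
  simp [crossedMul, mulId_one]

lemma crossedMul_tmul_left (R : V ⊗[k] A →ₗ[k] A ⊗[k] V) (σ : V ⊗[k] V →ₗ[k] A ⊗[k] V)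
    (a : A) (v : V) (y : A ⊗[k] V) :
    crossedMul R σ ((a ⊗ₜ v) ⊗ₜ y) =
      mulId k A V (a ⊗ₜ extLeft σ
        (R.rTensor V ((TensorProduct.assoc k V A V).symm (v ⊗ₜ y)))) := by
  rw [← crossedMul_one_left, ← crossedMul_mulId, mulId_tmul, mul_one]

section

variable (R : V ⊗[k] A →ₗ[k] A ⊗[k] V) (σ : V ⊗[k] V →ₗ[k] A ⊗[k] V)
  (θ γ : V →ₗ[k] A ⊗[k] V)

lemma twistR_eq : twistR R θ γ = extOne γ ∘ₗ extLeft R ∘ₗ θ.rTensor A := by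
  simp only [twistR, extLeft, ← LinearMap.comp_assoc, extOne_comp_mulId]

lemma twistR_tmul (v : V) (a : A) :
    twistR R θ γ (v ⊗ₜ a) = extOne γ (extLeft R (θ v ⊗ₜ a)) := by
  simp [twistR_eq]

lemma twistSigma_tmul (v w : V) :
    twistSigma R σ θ γ (v ⊗ₜ w) = extOne γ (crossedMul R σ (θ v ⊗ₜ θ w)) := rfl

lemma extLeft_twistR :
    extLeft (twistR R θ γ) = extOne γ ∘ₗ extLeft R ∘ₗ (extOne θ).rTensor A := by
  ext a v b
  simp [twistR_tmul, extOne_mulId, ext_mulId]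

lemma extLeft_twistSigma :
    extLeft (twistSigma R σ θ γ) =
      extOne γ ∘ₗ crossedMul R σ ∘ₗ TensorProduct.map (extOne θ) θ := by
  ext a v w
  simp [twistSigma_tmul, extOne_mulId, crossedMul_mulId]

end

variable {one : V} {R : V ⊗[k] A →ₗ[k] A ⊗[k] V} {σ : V ⊗[k] V →ₗ[k] A ⊗[k] V}
  {θ γ : V →ₗ[k] A ⊗[k] V}

namespace IsCrossed

lemma extLeft_R (h : IsCrossed one R σ) (x : A ⊗[k] V) (a : A) :
    extLeft R (x ⊗ₜ a) = crossedMul R σ (x ⊗ₜ (a ⊗ₜ one)) := by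
  rw [← h.mul_one' (extLeft R (x ⊗ₜ a)), ← h.crossedMul_mulId_right, mulId_tmul, mul_one]

lemma crossedMul_one_tmul_extOne (h : IsCrossed one R σ) (v : V) (y : A ⊗[k] V) :
    crossedMul R σ ((1 ⊗ₜ v) ⊗ₜ extOne θ y) =
      crossedMul R σ (θ.lTensor (A ⊗[k] V)
        (R.rTensor V ((TensorProduct.assoc k V A V).symm (v ⊗ₜ y)))) := by
  induction y with
  | zero => simp
  | tmul b w => simp [h.crossedMul_mulId_right, mulId_one]
  | add y y' hy hy' => simp only [TensorProduct.tmul_add, map_add, hy, hy']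

theorem twistConditions (h : IsCrossed one R σ) (hθ : θ one = 1 ⊗ₜ one)
    (hγ : γ one = 1 ⊗ₜ one) (hγθ : ∀ v, extOne γ (θ v) = 1 ⊗ₜ v)
    (hθγ : ∀ v, extOne θ (γ v) = 1 ⊗ₜ v) :
    TwistConditions one R σ θ γ where
  θ_one := hθ
  γ_one := hγ
  γ_θ := hγθ
  θ_γ := hθγ
  γ_σ := by
    ext v w
    have cancel_θ (z : (A ⊗[k] V) ⊗[k] V) :
        extLeft (twistSigma R σ θ γ) ((extOne γ).rTensor V z) =
          extOne γ (crossedMul R σ (θ.lTensor (A ⊗[k] V) z)) := by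
      suffices extLeft (twistSigma R σ θ γ) ∘ₗ (extOne γ).rTensor V =
          extOne γ ∘ₗ crossedMul R σ ∘ₗ θ.lTensor (A ⊗[k] V) from LinearMap.congr_fun this z
      refine TensorProduct.ext' fun x u => ?_
      simp [extLeft_twistSigma, extOne_extOne hθγ]
    calc _ = extLeft (twistSigma R σ θ γ) ((extOne γ).rTensor V
          (R.rTensor V ((TensorProduct.assoc k V A V).symm (v ⊗ₜ γ w)))) :=
          LinearMap.congr_fun (mulId_map_mul'_lTensor _ γ) _
      _ = extOne γ (crossedMul R σ ((1 ⊗ₜ v) ⊗ₜ extOne θ (γ w))) := by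
          rw [cancel_θ, h.crossedMul_one_tmul_extOne]
      _ = _ := by simp [hθγ, crossedMul_one_left, h.R_one_right, mulId_one]

lemma extOne_crossedMul_twist (h : IsCrossed one R σ) (hθγ : ∀ v, extOne θ (γ v) = 1 ⊗ₜ v)
    (x y : A ⊗[k] V) :
    extOne θ (crossedMul (twistR R θ γ) (twistSigma R σ θ γ) (x ⊗ₜ y)) =
      crossedMul R σ (extOne θ x ⊗ₜ extOne θ y) := by
  suffices extOne θ ∘ₗ crossedMul (twistR R θ γ) (twistSigma R σ θ γ) =
      crossedMul R σ ∘ₗ TensorProduct.map (extOne θ) (extOne θ) from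
    LinearMap.congr_fun this (x ⊗ₜ y)
  ext a v b w
  simp [crossedMul_tmul, extLeft_twistSigma, twistR_tmul, extOne_mulId, extOne_extOne hθγ,
    crossedMul_mulId, ext_mulId, h.crossedMul_mulId_right]

theorem twist (h : IsCrossed one R σ) (t : TwistConditions one R σ θ γ) :
    IsCrossed one (twistR R θ γ) (twistSigma R σ θ γ) where
  R_one_left a := by simp [twistR_tmul, t.θ_one, h.R_one_left, t.γ_one]
  R_one_right v := by simp [twistR_tmul, h.extLeft_R, h.mul_one', t.γ_θ]
  σ_one_left v := by simp [twistSigma_tmul, t.θ_one, h.one_mul', t.γ_θ]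
  σ_one_right v := by simp [twistSigma_tmul, t.θ_one, h.mul_one', t.γ_θ]
  R_mul := by
    ext v a b
    have mul_tmul_one : crossedMul R σ ((a ⊗ₜ one) ⊗ₜ (b ⊗ₜ one)) = (a * b) ⊗ₜ one := by
      simp [crossedMul_tmul, h.R_one_left, h.σ_one_left]
    simp [twistR_tmul, extLeft_twistR, extOne_extOne t.θ_γ, ← mul_tmul_one,
      h.extLeft_R, h.mul_assoc']
  cocycle := by
    ext v w u
    suffices crossedMul (twistR R θ γ) (twistSigma R σ θ γ)
          ((1 ⊗ₜ v) ⊗ₜ twistSigma R σ θ γ (w ⊗ₜ u)) =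
        extLeft (twistSigma R σ θ γ) (twistSigma R σ θ γ (v ⊗ₜ w) ⊗ₜ u) by
      simpa [crossedMul_one_left] using this
    apply extOne_injective t.γ_θ
    simp [h.extOne_crossedMul_twist t.θ_γ, extLeft_twistSigma, twistSigma_tmul,
      extOne_extOne t.θ_γ, mulId_one, h.mul_assoc']
  twisted := by
    ext v w a
    suffices crossedMul (twistR R θ γ) (twistSigma R σ θ γ)
          ((1 ⊗ₜ v) ⊗ₜ twistR R θ γ (w ⊗ₜ a)) =
        extLeft (twistR R θ γ) (twistSigma R σ θ γ (v ⊗ₜ w) ⊗ₜ a) by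
      simpa [crossedMul_one_left] using this
    apply extOne_injective t.γ_θ
    simp [h.extOne_crossedMul_twist t.θ_γ, extLeft_twistR, twistSigma_tmul, twistR_tmul,
      extOne_extOne t.θ_γ, mulId_one, h.extLeft_R, h.mul_assoc']

end IsCrossed

/-- The isomorphism `A ⊗_{R',σ'} V → A ⊗_{R,σ} V`, `a ⊗ v ↦ a θ(v)`. -/
def twistEquiv (h : IsCrossed one R σ) (t : TwistConditions one R σ θ γ)
    {R' : V ⊗[k] A →ₗ[k] A ⊗[k] V} {σ' : V ⊗[k] V →ₗ[k] A ⊗[k] V} (h' : IsCrossed one R' σ')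
    (hR : twistR R θ γ = R') (hσ : twistSigma R σ θ γ = σ') :
    CrossedProduct h' ≃ₐ[k] CrossedProduct h :=
  AlgEquiv.ofLinearEquiv
    ((CrossedProduct.of h').symm ≪≫ₗ
      LinearEquiv.ofLinearMap (extOne θ) (extOne γ) (LinearMap.ext (extOne_extOne t.θ_γ))
        (LinearMap.ext (extOne_extOne t.γ_θ)) ≪≫ₗ CrossedProduct.of h)
    (show extOne θ (1 ⊗ₜ one) = 1 ⊗ₜ one by rw [extOne_tmul, t.θ_one, mulId_one])
    (by subst hR hσ; exact h.extOne_crossedMul_twist t.θ_γ)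

lemma twistEquiv_of_tmul (h : IsCrossed one R σ) (t : TwistConditions one R σ θ γ)
    {R' : V ⊗[k] A →ₗ[k] A ⊗[k] V} {σ' : V ⊗[k] V →ₗ[k] A ⊗[k] V} (h' : IsCrossed one R' σ')
    (hR : twistR R θ γ = R') (hσ : twistSigma R σ θ γ = σ') (a : A) (v : V) :
    twistEquiv h t h' hR hσ (CrossedProduct.of h' (a ⊗ₜ v)) =
      CrossedProduct.of h (mulId k A V (a ⊗ₜ θ v)) :=
  rfl

end Twist

section BaseChange

variable {k A B V W W' : Type*} [Field k] [Ring A] [Algebra k A] [Ring B] [Algebra k B]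
  [AddCommGroup V] [Module k V] [AddCommGroup W] [Module k W] [AddCommGroup W'] [Module k W']
  (i : A →ₐ[k] B)

lemma rTensor_comp_mulId :
    i.toLinearMap.rTensor V ∘ₗ mulId k A V =
      mulId k B V ∘ₗ TensorProduct.map i.toLinearMap (i.toLinearMap.rTensor V) := by
  ext a b v
  simp

lemma rTensor_comp_extOne (g : V →ₗ[k] A ⊗[k] V) :
    i.toLinearMap.rTensor V ∘ₗ extOne g =
      extOne (i.toLinearMap.rTensor V ∘ₗ g) ∘ₗ i.toLinearMap.rTensor V := by
  ext a v
  simpa using LinearMap.congr_fun (rTensor_comp_mulId i) (a ⊗ₜ g v)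

lemma rTensor_comp_extLeft {τ : V ⊗[k] W →ₗ[k] A ⊗[k] V} {τ' : V ⊗[k] W' →ₗ[k] B ⊗[k] V}
    {j : W →ₗ[k] W'} (h : i.toLinearMap.rTensor V ∘ₗ τ = τ' ∘ₗ j.lTensor V) :
    i.toLinearMap.rTensor V ∘ₗ extLeft τ =
      extLeft τ' ∘ₗ TensorProduct.map (i.toLinearMap.rTensor V) j := by
  ext a v w
  have h_tmul : i.toLinearMap.rTensor V (τ (v ⊗ₜ w)) = τ' (v ⊗ₜ j w) :=
    LinearMap.congr_fun h (v ⊗ₜ w)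
  simpa [h_tmul] using LinearMap.congr_fun (rTensor_comp_mulId i) (a ⊗ₜ τ (v ⊗ₜ w))

lemma rTensor_comp_crossedMul {R : V ⊗[k] A →ₗ[k] A ⊗[k] V} {R' : V ⊗[k] B →ₗ[k] B ⊗[k] V}
    (hR : i.toLinearMap.rTensor V ∘ₗ R = R' ∘ₗ i.toLinearMap.lTensor V)
    (σ : V ⊗[k] V →ₗ[k] A ⊗[k] V) :
    i.toLinearMap.rTensor V ∘ₗ crossedMul R σ =
      crossedMul R' (i.toLinearMap.rTensor V ∘ₗ σ) ∘ₗ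
        TensorProduct.map (i.toLinearMap.rTensor V) (i.toLinearMap.rTensor V) := by
  have h_extLeft_R (x : A ⊗[k] V) (b : A) :
      i.toLinearMap.rTensor V (extLeft R (x ⊗ₜ b)) =
        extLeft R' (i.toLinearMap.rTensor V x ⊗ₜ i b) :=
    LinearMap.congr_fun (rTensor_comp_extLeft i hR) (x ⊗ₜ b)
  have h_extLeft_σ (x : A ⊗[k] V) (w : V) :
      i.toLinearMap.rTensor V (extLeft σ (x ⊗ₜ w)) =
        extLeft (i.toLinearMap.rTensor V ∘ₗ σ) (i.toLinearMap.rTensor V x ⊗ₜ w) :=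
    LinearMap.congr_fun (rTensor_comp_extLeft i (j := LinearMap.id) (by simp)) (x ⊗ₜ w)
  refine TensorProduct.ext' fun x y => ?_
  induction y with
  | zero => simp
  | add y y' hy hy' => simp only [TensorProduct.tmul_add, map_add, hy, hy']
  | tmul b w =>
    simp only [crossedMul_eq, LinearMap.comp_apply, LinearEquiv.coe_coe,
      TensorProduct.assoc_symm_tmul, LinearMap.rTensor_tmul, TensorProduct.map_tmul, h_extLeft_σ,
      h_extLeft_R, AlgHom.toLinearMap_apply]

variable {i} {R : V ⊗[k] A →ₗ[k] A ⊗[k] V} {R' : V ⊗[k] B →ₗ[k] B ⊗[k] V}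

lemma rTensor_comp_twistR (hR : i.toLinearMap.rTensor V ∘ₗ R = R' ∘ₗ i.toLinearMap.lTensor V)
    (θ γ : V →ₗ[k] A ⊗[k] V) :
    i.toLinearMap.rTensor V ∘ₗ twistR R θ γ =
      twistR R' (i.toLinearMap.rTensor V ∘ₗ θ) (i.toLinearMap.rTensor V ∘ₗ γ) ∘ₗ
        i.toLinearMap.lTensor V := by
  ext v a
  have h_extOne := LinearMap.congr_fun (rTensor_comp_extOne i γ)
  have h_extLeft := LinearMap.congr_fun (rTensor_comp_extLeft i hR)
  simp_all [twistR_tmul]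

lemma rTensor_comp_twistSigma
    (hR : i.toLinearMap.rTensor V ∘ₗ R = R' ∘ₗ i.toLinearMap.lTensor V)
    (σ : V ⊗[k] V →ₗ[k] A ⊗[k] V) (θ γ : V →ₗ[k] A ⊗[k] V) :
    i.toLinearMap.rTensor V ∘ₗ twistSigma R σ θ γ =
      twistSigma R' (i.toLinearMap.rTensor V ∘ₗ σ) (i.toLinearMap.rTensor V ∘ₗ θ)
        (i.toLinearMap.rTensor V ∘ₗ γ) := by
  ext v w
  have h_extOne := LinearMap.congr_fun (rTensor_comp_extOne i γ)
  have h_crossedMul := LinearMap.congr_fun (rTensor_comp_crossedMul i hR σ)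
  simp_all [twistSigma_tmul]

end BaseChange

section Colinear

variable {k C M N L X Y Z : Type*} [CommSemiring k] [AddCommMonoid C] [Module k C]
  [AddCommMonoid M] [Module k M] [AddCommMonoid N] [Module k N] [AddCommMonoid L] [Module k L]
  [AddCommMonoid X] [Module k X] [AddCommMonoid Y] [Module k Y] [AddCommMonoid Z] [Module k Z]

/-- `φ` commutes with the maps `ρ` and `ρ'`, thought of as right coactions of `C`. The comodule
axioms are not imposed: coassociativity of `ρ` is colinearity of `ρ` itself, as a map into the
cofree comodule `lTensorCoaction M comul`. -/
def IsColinear (ρ : M →ₗ[k] M ⊗[k] C) (ρ' : N →ₗ[k] N ⊗[k] C) (φ : M →ₗ[k] N) : Prop :=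
  ρ' ∘ₗ φ = φ.rTensor C ∘ₗ ρ

variable (Y) in
/-- The coaction `y ⊗ m ↦ (y ⊗ m₀) ⊗ m₁` on `Y ⊗ M`; for `ρ = Δ` it is the cofree comodule on
`Y`. -/
def lTensorCoaction (ρ : M →ₗ[k] M ⊗[k] C) : Y ⊗[k] M →ₗ[k] (Y ⊗[k] M) ⊗[k] C :=
  (TensorProduct.assoc k Y M C).symm.toLinearMap ∘ₗ ρ.lTensor Y

/-- The coaction `m ⊗ z ↦ m₀ ⊗ T(m₁ ⊗ z)` on `M ⊗ Z`. -/
def twistedCoaction (T : C ⊗[k] Z →ₗ[k] Z ⊗[k] C) (ρ : M →ₗ[k] M ⊗[k] C) :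
    M ⊗[k] Z →ₗ[k] (M ⊗[k] Z) ⊗[k] C :=
  (TensorProduct.assoc k M Z C).symm.toLinearMap ∘ₗ T.lTensor M ∘ₗ
    (TensorProduct.assoc k M C Z).toLinearMap ∘ₗ ρ.rTensor Z

/-- The map `c ⊗ (x ⊗ z) ↦ T₂₃ (S₁₂ (c ⊗ x ⊗ z))` moving `C` past `X` by `S` and then past `Z`
by `T`. -/
def compEntwining (S : C ⊗[k] X →ₗ[k] X ⊗[k] C) (T : C ⊗[k] Z →ₗ[k] Z ⊗[k] C) :
    C ⊗[k] (X ⊗[k] Z) →ₗ[k] (X ⊗[k] Z) ⊗[k] C :=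
  (TensorProduct.assoc k X Z C).symm.toLinearMap ∘ₗ T.lTensor X ∘ₗ
    (TensorProduct.assoc k X C Z).toLinearMap ∘ₗ S.rTensor Z ∘ₗ
    (TensorProduct.assoc k C X Z).symm.toLinearMap

/-- The map `m ↦ G(m₀) ⊗ m₁` into the cofree comodule on `Y` induced by `G`. -/
def colift (ρ : M →ₗ[k] M ⊗[k] C) (G : M →ₗ[k] Y) : M →ₗ[k] Y ⊗[k] C :=
  G.rTensor C ∘ₗ ρ

lemma colift_apply (ρ : M →ₗ[k] M ⊗[k] C) (G : M →ₗ[k] Y) (m : M) :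
    colift ρ G m = G.rTensor C (ρ m) := rfl

variable {ρ : M →ₗ[k] M ⊗[k] C} {ρ' : N →ₗ[k] N ⊗[k] C} {ρ'' : L →ₗ[k] L ⊗[k] C}

lemma IsColinear.comp {ψ : N →ₗ[k] L} {φ : M →ₗ[k] N} (hψ : IsColinear ρ' ρ'' ψ)
    (hφ : IsColinear ρ ρ' φ) : IsColinear ρ ρ'' (ψ ∘ₗ φ) := by
  unfold IsColinear at *
  rw [← LinearMap.comp_assoc, hψ, LinearMap.comp_assoc, hφ, LinearMap.rTensor_comp,
    LinearMap.comp_assoc]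

lemma IsColinear.lTensor {φ : M →ₗ[k] N} (hφ : IsColinear ρ ρ' φ) :
    IsColinear (lTensorCoaction Y ρ) (lTensorCoaction Y ρ') (φ.lTensor Y) := by
  simp only [IsColinear, lTensorCoaction, coassoc_simps] at *
  simp only [hφ, coassoc_simps]

lemma IsColinear.rTensor (T : C ⊗[k] Z →ₗ[k] Z ⊗[k] C) {φ : M →ₗ[k] N}
    (hφ : IsColinear ρ ρ' φ) :
    IsColinear (twistedCoaction T ρ) (twistedCoaction T ρ') (φ.rTensor Z) := by
  simp only [IsColinear, twistedCoaction, coassoc_simps] at *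
  simp only [hφ, coassoc_simps]

lemma isColinear_lTensor {S : C ⊗[k] X →ₗ[k] X ⊗[k] C} {T : C ⊗[k] Z →ₗ[k] Z ⊗[k] C}
    {j : X →ₗ[k] Z} (h : T ∘ₗ j.lTensor C = j.rTensor C ∘ₗ S) (ρ : M →ₗ[k] M ⊗[k] C) :
    IsColinear (twistedCoaction S ρ) (twistedCoaction T ρ) (j.lTensor M) := by
  have h_tmul (c : C) (x : X) : T (c ⊗ₜ j x) = j.rTensor C (S (c ⊗ₜ x)) :=
    LinearMap.congr_fun h (c ⊗ₜ x)
  ext m x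
  simp only [twistedCoaction, TensorProduct.AlgebraTensorModule.curry_apply,
    TensorProduct.curry_apply, LinearMap.coe_restrictScalars, LinearMap.comp_apply,
    LinearMap.lTensor_tmul, LinearMap.rTensor_tmul, LinearEquiv.coe_coe]
  induction ρ m with
  | zero => simp
  | add u v hu hv => simp only [TensorProduct.add_tmul, map_add, hu, hv]
  | tmul m' c =>
    simp only [TensorProduct.assoc_tmul, LinearMap.lTensor_tmul, h_tmul]
    induction S (c ⊗ₜ x) with
    | zero => simp
    | add u v hu hv => simp only [TensorProduct.tmul_add, map_add, hu, hv]
    | tmul x' c' => simp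

lemma isColinear_assoc (T : C ⊗[k] Z →ₗ[k] Z ⊗[k] C) (ρ : M →ₗ[k] M ⊗[k] C) :
    IsColinear (twistedCoaction T (lTensorCoaction Y ρ)) (lTensorCoaction Y (twistedCoaction T ρ))
      (TensorProduct.assoc k Y M Z).toLinearMap := by
  refine TensorProduct.ext_threefold fun y m z => ?_
  simp only [lTensorCoaction, twistedCoaction, LinearMap.comp_apply, LinearEquiv.coe_coe,
    TensorProduct.assoc_tmul, LinearMap.lTensor_tmul, LinearMap.rTensor_tmul]
  induction ρ m with
  | zero => simp
  | add u v hu hv => simp only [TensorProduct.tmul_add, TensorProduct.add_tmul, map_add, hu, hv]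
  | tmul m' c =>
    simp only [TensorProduct.assoc_tmul, LinearMap.lTensor_tmul, TensorProduct.assoc_symm_tmul]
    induction T (c ⊗ₜ z) with
    | zero => simp
    | add u v hu hv => simp only [TensorProduct.tmul_add, map_add, hu, hv]
    | tmul z' c' => simp

lemma isColinear_assoc_symm_compEntwining (S : C ⊗[k] X →ₗ[k] X ⊗[k] C)
    (T : C ⊗[k] Z →ₗ[k] Z ⊗[k] C) (ρ : M →ₗ[k] M ⊗[k] C) :
    IsColinear (twistedCoaction (compEntwining S T) ρ) (twistedCoaction T (twistedCoaction S ρ))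
      (TensorProduct.assoc k M X Z).symm.toLinearMap := by
  ext m x z
  simp only [twistedCoaction, compEntwining, TensorProduct.AlgebraTensorModule.curry_apply,
    TensorProduct.curry_apply, LinearMap.coe_restrictScalars, LinearMap.comp_apply,
    LinearEquiv.coe_coe, TensorProduct.assoc_symm_tmul, LinearMap.rTensor_tmul]
  induction ρ m with
  | zero => simp
  | add u v hu hv => simp only [TensorProduct.add_tmul, map_add, hu, hv]
  | tmul m' c =>
    simp only [TensorProduct.assoc_tmul, LinearMap.lTensor_tmul, LinearMap.comp_apply,
      TensorProduct.assoc_symm_tmul, LinearMap.rTensor_tmul, LinearEquiv.coe_coe]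
    induction S (c ⊗ₜ x) with
    | zero => simp
    | add u v hu hv => simp only [TensorProduct.tmul_add, TensorProduct.add_tmul, map_add, hu, hv]
    | tmul x' c' =>
      simp only [TensorProduct.assoc_tmul, LinearMap.lTensor_tmul,
        TensorProduct.assoc_symm_tmul]
      induction T (c' ⊗ₜ z) with
      | zero => simp
      | add u v hu hv => simp only [TensorProduct.tmul_add, map_add, hu, hv]
      | tmul z' d => simp

lemma isColinear_assoc_symm (ρ : M →ₗ[k] M ⊗[k] C) :
    IsColinear (lTensorCoaction X (lTensorCoaction Y ρ)) (lTensorCoaction (X ⊗[k] Y) ρ)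
      (TensorProduct.assoc k X Y M).symm.toLinearMap := by
  ext y m z
  simp only [lTensorCoaction, TensorProduct.AlgebraTensorModule.curry_apply,
    TensorProduct.curry_apply, LinearMap.coe_restrictScalars, LinearMap.comp_apply,
    LinearEquiv.coe_coe, TensorProduct.assoc_symm_tmul, LinearMap.lTensor_tmul]
  induction ρ z with
  | zero => simp
  | add u v hu hv => simp only [TensorProduct.tmul_add, map_add, hu, hv]
  | tmul m' c => simp

lemma isColinear_rTensor (g : X →ₗ[k] Y) (ρ : M →ₗ[k] M ⊗[k] C) :
    IsColinear (lTensorCoaction X ρ) (lTensorCoaction Y ρ) (g.rTensor M) := by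
  simp only [IsColinear, lTensorCoaction, coassoc_simps]

section Coalgebra

variable [Coalgebra k C]

lemma IsColinear.isColinear_colift (h : IsColinear ρ (lTensorCoaction M comul) ρ) (G : M →ₗ[k] Y) :
    IsColinear ρ (lTensorCoaction Y comul) (colift ρ G) :=
  (isColinear_rTensor G comul).comp h

lemma IsColinear.isColinear_twistedCoaction (h : IsColinear ρ (lTensorCoaction M comul) ρ)
    {T : C ⊗[k] Z →ₗ[k] Z ⊗[k] C}
    (hT : IsColinear (twistedCoaction T comul) (lTensorCoaction Z comul) T) :
    IsColinear (twistedCoaction T ρ) (lTensorCoaction (M ⊗[k] Z) comul) (twistedCoaction T ρ) :=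
  (isColinear_assoc_symm comul).comp <| hT.lTensor.comp <| (isColinear_assoc T comul).comp <|
    h.rTensor T

lemma isColinear_comul :
    IsColinear (comul (R := k) (A := C)) (lTensorCoaction C comul) comul :=
  coassoc_symm

lemma isColinear_colift_comul (ν : C →ₗ[k] Y) :
    IsColinear comul (lTensorCoaction Y comul) (colift comul ν) :=
  isColinear_comul.isColinear_colift ν

variable (k C Y) in
/-- The map `id ⊗ ε : Y ⊗ C → Y`, the counit of the cofree comodule on `Y`. -/
def lTensorCounit : Y ⊗[k] C →ₗ[k] Y :=
  (TensorProduct.rid k Y).toLinearMap ∘ₗ counit.lTensor Y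

lemma lTensorCounit_comp_rTensor (g : X →ₗ[k] Y) :
    lTensorCounit k C Y ∘ₗ g.rTensor C = g ∘ₗ lTensorCounit k C X := by
  ext x c
  simp [lTensorCounit]

lemma lTensorCounit_comp_colift (ν : C →ₗ[k] Y) :
    lTensorCounit k C Y ∘ₗ colift comul ν = ν := by
  rw [colift, ← LinearMap.comp_assoc, lTensorCounit_comp_rTensor]
  ext c
  simp [lTensorCounit]

lemma lTensorCounit_rTensor_lTensorCoaction :
    (lTensorCounit k C Y).rTensor C ∘ₗ lTensorCoaction Y comul = LinearMap.id := by
  ext y c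
  have h_counit : TensorProduct.lid k C (counit.rTensor C (comul (R := k) c)) = c := by simp
  simp only [lTensorCounit, lTensorCoaction, TensorProduct.AlgebraTensorModule.curry_apply,
    TensorProduct.curry_apply, LinearMap.coe_restrictScalars, LinearMap.comp_apply,
    LinearMap.lTensor_tmul, LinearMap.id_apply]
  conv_rhs => rw [← h_counit]
  induction comul (R := k) c with
  | zero => simp
  | add u v hu hv => simp only [TensorProduct.tmul_add, map_add, hu, hv]
  | tmul c₁ c₂ => simp [TensorProduct.smul_tmul]

lemma IsColinear.eq_colift {φ : M →ₗ[k] Y ⊗[k] C} (h : IsColinear ρ (lTensorCoaction Y comul) φ) :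
    φ = colift ρ (lTensorCounit k C Y ∘ₗ φ) := by
  rw [colift, LinearMap.rTensor_comp, LinearMap.comp_assoc, ← h, ← LinearMap.comp_assoc,
    lTensorCounit_rTensor_lTensorCoaction, LinearMap.id_comp]

end Coalgebra

end Colinear

section ColinearTwist

variable {k A C V W : Type*} [Field k] [Ring A] [Algebra k A] [AddCommGroup C] [Module k C]
  [AddCommGroup V] [Module k V] [AddCommGroup W] [Module k W]
  {ρ : V →ₗ[k] V ⊗[k] C}

lemma isColinear_mulId (ρ : V →ₗ[k] V ⊗[k] C) :
    IsColinear (lTensorCoaction A (lTensorCoaction A ρ)) (lTensorCoaction A ρ) (mulId k A V) :=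
  (isColinear_rTensor (LinearMap.mul' k A) ρ).comp (isColinear_assoc_symm ρ)

lemma IsColinear.extOne {g : V →ₗ[k] A ⊗[k] V}
    (hg : IsColinear ρ (lTensorCoaction A ρ) g) :
    IsColinear (lTensorCoaction A ρ) (lTensorCoaction A ρ) (extOne g) :=
  (isColinear_mulId ρ).comp hg.lTensor

lemma IsColinear.extLeft {T : C ⊗[k] W →ₗ[k] W ⊗[k] C}
    {τ : V ⊗[k] W →ₗ[k] A ⊗[k] V}
    (hτ : IsColinear (twistedCoaction T ρ) (lTensorCoaction A ρ) τ) :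
    IsColinear (twistedCoaction T (lTensorCoaction A ρ)) (lTensorCoaction A ρ) (extLeft τ) :=
  (isColinear_mulId ρ).comp (hτ.lTensor.comp (isColinear_assoc T ρ))

variable {S : C ⊗[k] A →ₗ[k] A ⊗[k] C} {T : C ⊗[k] V →ₗ[k] V ⊗[k] C}
  {R : V ⊗[k] A →ₗ[k] A ⊗[k] V} {σ : V ⊗[k] V →ₗ[k] A ⊗[k] V} {θ γ : V →ₗ[k] A ⊗[k] V}

lemma IsColinear.twistR (hR : IsColinear (twistedCoaction S ρ) (lTensorCoaction A ρ) R)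
    (hθ : IsColinear ρ (lTensorCoaction A ρ) θ) (hγ : IsColinear ρ (lTensorCoaction A ρ) γ) :
    IsColinear (twistedCoaction S ρ) (lTensorCoaction A ρ) (twistR R θ γ) := by
  rw [twistR_eq]
  exact hγ.extOne.comp (hR.extLeft.comp (hθ.rTensor S))

lemma IsColinear.crossedMul (hR : IsColinear (twistedCoaction S ρ) (lTensorCoaction A ρ) R)
    (hσ : IsColinear (twistedCoaction T ρ) (lTensorCoaction A ρ) σ) :
    IsColinear (twistedCoaction (compEntwining S T) (lTensorCoaction A ρ)) (lTensorCoaction A ρ)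
      (crossedMul R σ) := by
  rw [crossedMul_eq]
  exact hσ.extLeft.comp ((hR.extLeft.rTensor T).comp (isColinear_assoc_symm_compEntwining S T _))

lemma IsColinear.twistSigma (hR : IsColinear (twistedCoaction S ρ) (lTensorCoaction A ρ) R)
    (hσ : IsColinear (twistedCoaction T ρ) (lTensorCoaction A ρ) σ)
    (hθ : IsColinear ρ (lTensorCoaction A ρ) θ) (hγ : IsColinear ρ (lTensorCoaction A ρ) γ)
    (hθT : compEntwining S T ∘ₗ θ.lTensor C = θ.rTensor C ∘ₗ T) :
    IsColinear (twistedCoaction T ρ) (lTensorCoaction A ρ) (twistSigma R σ θ γ) := by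
  rw [CrossedProd.twistSigma, ← LinearMap.lTensor_comp_rTensor]
  exact hγ.extOne.comp ((hR.crossedMul hσ).comp ((isColinear_lTensor hθT _).comp (hθ.rTensor T)))

end ColinearTwist

section Convolution

variable {k A C : Type*} [Field k] [Ring A] [Algebra k A] [AddCommGroup C] [Module k C]
  [Coalgebra k C]

lemma lTensorCounit_mulId (a : A) (x : A ⊗[k] C) :
    lTensorCounit k C A (mulId k A C (a ⊗ₜ x)) = a * lTensorCounit k C A x := by
  induction x with
  | zero => simp
  | tmul b c => simp [lTensorCounit]
  | add x y hx hy => simp only [TensorProduct.tmul_add, map_add, hx, hy, mul_add]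

lemma lTensorCounit_comp_extOne_colift (ν : C →ₗ[k] A) :
    lTensorCounit k C A ∘ₗ extOne (colift comul ν) = LinearMap.mul' k A ∘ₗ ν.lTensor A := by
  ext a c
  have h_ν : lTensorCounit k C A (colift comul ν c) = ν c :=
    LinearMap.congr_fun (lTensorCounit_comp_colift ν) c
  simp [lTensorCounit_mulId, h_ν]

lemma lTensorCounit_extOne_colift (ν : C →ₗ[k] A) (x : A ⊗[k] C) :
    lTensorCounit k C A (extOne (colift comul ν) x) = LinearMap.mul' k A (ν.lTensor A x) :=
  LinearMap.congr_fun (lTensorCounit_comp_extOne_colift ν) x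

lemma extOne_colift {ν ν' : C →ₗ[k] A} (h : WithConv.toConv ν * WithConv.toConv ν' = 1) (c : C) :
    extOne (colift comul ν') (colift comul ν c) = 1 ⊗ₜ c := by
  have h_conv : LinearMap.mul' k A ∘ₗ TensorProduct.map ν ν' ∘ₗ comul (R := k) (A := C) =
      Algebra.linearMap k A ∘ₗ counit :=
    congrArg WithConv.ofConv h
  have h_counit : lTensorCounit k C A ∘ₗ extOne (colift comul ν') ∘ₗ colift comul ν =
      Algebra.linearMap k A ∘ₗ counit := by
    rw [← LinearMap.comp_assoc, lTensorCounit_comp_extOne_colift, ← h_conv, colift,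
      ← LinearMap.lTensor_comp_rTensor]
    rfl
  have h_colinear :=
    ((isColinear_colift_comul ν').extOne.comp (isColinear_colift_comul ν)).eq_colift
  calc extOne (colift comul ν') (colift comul ν c)
      = colift comul (Algebra.linearMap k A ∘ₗ counit) c := by
        rw [← h_counit]
        exact LinearMap.congr_fun h_colinear c
    _ = 1 ⊗ₜ c := by simp [colift, LinearMap.rTensor_comp]

lemma lTensorCounit_comp_twistR (R : C ⊗[k] A →ₗ[k] A ⊗[k] C) (ν ν' : C →ₗ[k] A) :
    lTensorCounit k C A ∘ₗ twistR R (colift comul ν) (colift comul ν') =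
      LinearMap.mul' k A ∘ₗ TensorProduct.map ν (LinearMap.mul' k A ∘ₗ ν'.lTensor A ∘ₗ R) ∘ₗ
        (TensorProduct.assoc k C C A).toLinearMap ∘ₗ comul.rTensor A := by
  ext c a
  simp only [TensorProduct.AlgebraTensorModule.curry_apply, TensorProduct.curry_apply,
    LinearMap.coe_restrictScalars, LinearMap.comp_apply, LinearEquiv.coe_coe, twistR_tmul,
    LinearMap.rTensor_tmul]
  rw [colift_apply comul ν]
  induction comul (R := k) c with
  | zero => simp
  | tmul c₁ c₂ => simp [extOne_mulId, lTensorCounit_mulId, lTensorCounit_extOne_colift]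
  | add x y hx hy => simp only [TensorProduct.add_tmul, map_add, hx, hy]

lemma lTensorCounit_extOne_colift_extLeft (σ : C ⊗[k] C →ₗ[k] A ⊗[k] C) (ν : C →ₗ[k] A)
    (z : (A ⊗[k] C) ⊗[k] C) :
    lTensorCounit k C A (extOne (colift comul ν) (extLeft σ z)) =
      LinearMap.mul' k A ((LinearMap.mul' k A ∘ₗ ν.lTensor A ∘ₗ σ).lTensor A
        (TensorProduct.assoc k A C C z)) := by
  suffices lTensorCounit k C A ∘ₗ extOne (colift comul ν) ∘ₗ extLeft σ =
      LinearMap.mul' k A ∘ₗ (LinearMap.mul' k A ∘ₗ ν.lTensor A ∘ₗ σ).lTensor A ∘ₗ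
        (TensorProduct.assoc k A C C).toLinearMap from LinearMap.congr_fun this z
  ext a c d
  simp [extOne_mulId, lTensorCounit_mulId, lTensorCounit_extOne_colift]

lemma lTensorCounit_comp_twistSigma (R : C ⊗[k] A →ₗ[k] A ⊗[k] C) (σ : C ⊗[k] C →ₗ[k] A ⊗[k] C)
    (ν ν' : C →ₗ[k] A) :
    lTensorCounit k C A ∘ₗ twistSigma R σ (colift comul ν) (colift comul ν') =
      LinearMap.mul' k A ∘ₗ
        TensorProduct.map ν
          (LinearMap.mul' k A ∘ₗ (LinearMap.mul' k A ∘ₗ ν'.lTensor A ∘ₗ σ).lTensor A ∘ₗ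
            (TensorProduct.assoc k A C C).toLinearMap ∘ₗ R.rTensor C ∘ₗ
            (TensorProduct.assoc k C A C).symm.toLinearMap ∘ₗ (colift comul ν).lTensor C) ∘ₗ
        (TensorProduct.assoc k C C C).toLinearMap ∘ₗ comul.rTensor C := by
  refine TensorProduct.ext' fun c d => ?_
  simp only [LinearMap.comp_apply, twistSigma_tmul, LinearMap.rTensor_tmul, LinearEquiv.coe_coe]
  rw [colift_apply comul ν]
  induction comul (R := k) c with
  | zero => simp
  | add x y hx hy => simp only [TensorProduct.add_tmul, map_add, hx, hy]
  | tmul c₁ c₂ =>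
    simp [crossedMul_tmul_left, extOne_mulId, lTensorCounit_mulId,
      lTensorCounit_extOne_colift_extLeft]

end Convolution

namespace EntwiningData

variable {k P C : Type*} [Field k] [Ring P] [Algebra k P] [AddCommGroup C]
    [Module k C] [Coalgebra k C] (E : EntwiningData k P C)

lemma isColinear_Ψ : IsColinear (twistedCoaction E.Ψ comul) (lTensorCoaction P comul) E.Ψ := by
  rw [IsColinear, lTensorCoaction, LinearMap.comp_assoc, E.Ψ_comul]
  ext x
  simp [twistedCoaction]

lemma isColinear_ΨC : IsColinear (twistedCoaction E.ΨC comul) (lTensorCoaction C comul) E.ΨC := by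
  rw [IsColinear, lTensorCoaction, LinearMap.comp_assoc, E.ΨC_comul]
  ext x
  simp [twistedCoaction]

/-- The map `R_F = (F ⊗ id_C) ∘ (id_C ⊗ Ψ) ∘ (Δ ⊗ id_P)` on all of `C ⊗ P`; unlike `RF` it does
not require `R_F` to preserve the coinvariants. -/
def totalRF (F : C ⊗[k] P →ₗ[k] P) : C ⊗[k] P →ₗ[k] P ⊗[k] C :=
  colift (twistedCoaction E.Ψ comul) F

lemma isColinear_totalRF (F : C ⊗[k] P →ₗ[k] P) :
    IsColinear (twistedCoaction E.Ψ comul) (lTensorCoaction P comul) (E.totalRF F) :=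
  (isColinear_comul.isColinear_twistedCoaction E.isColinear_Ψ).isColinear_colift F

lemma isColinear_sigmaF (f : C ⊗[k] C →ₗ[k] E.coinv) :
    IsColinear (twistedCoaction E.ΨC comul) (lTensorCoaction E.coinv comul) (E.sigmaF f) :=
  (isColinear_comul.isColinear_twistedCoaction E.isColinear_ΨC).isColinear_colift f

lemma isColinear_coact (ν : C →ₗ[k] E.coinv) :
    IsColinear comul (lTensorCoaction E.coinv comul) (E.coact ν) :=
  isColinear_colift_comul ν

lemma isColinear_inclC :
    IsColinear (lTensorCoaction E.coinv comul) (lTensorCoaction P comul) E.inclC :=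
  isColinear_rTensor E.incl comul

lemma inclC_comp_coact (ν : C →ₗ[k] E.coinv) :
    E.inclC ∘ₗ E.coact ν = colift comul (E.incl ∘ₗ ν) := by
  rw [colift, LinearMap.rTensor_comp, LinearMap.comp_assoc]
  rfl

lemma preR_eq_totalRF_comp_lTensor (F : C ⊗[k] P →ₗ[k] P) :
    E.preR F = E.totalRF F ∘ₗ E.incl.lTensor C := by
  rw [preR, ← LinearMap.rTensor_comp_lTensor]
  rfl

lemma inclC_comp_RF (F : C ⊗[k] P →ₗ[k] P) (hF : E.MapsCoinv F) :
    E.inclC ∘ₗ E.RF F hF = E.preR F :=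
  LinearMap.ext (LinearMap.codRestrictOfInjective_comp_apply _ _ _ hF)

lemma rTensor_val_comp_RF (F : C ⊗[k] P →ₗ[k] P) (hF : E.MapsCoinv F) :
    E.coinv.val.toLinearMap.rTensor C ∘ₗ E.RF F hF =
      E.totalRF F ∘ₗ E.coinv.val.toLinearMap.lTensor C :=
  (E.inclC_comp_RF F hF).trans (E.preR_eq_totalRF_comp_lTensor F)

lemma twistR_totalRF (F : C ⊗[k] P →ₗ[k] P) (ν ν' : C →ₗ[k] E.coinv) :
    twistR (E.totalRF F) (E.inclC ∘ₗ E.coact ν) (E.inclC ∘ₗ E.coact ν') =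
      E.totalRF (E.twistF F ν ν') := by
  have h_colinear := (E.isColinear_totalRF F).twistR
    (E.isColinear_inclC.comp (E.isColinear_coact ν))
    (E.isColinear_inclC.comp (E.isColinear_coact ν'))
  rw [h_colinear.eq_colift, inclC_comp_coact, inclC_comp_coact, lTensorCounit_comp_twistR, twistF,
    ← LinearMap.lTensor_comp_rTensor _ F]
  rfl

lemma preR_twistF (F : C ⊗[k] P →ₗ[k] P) (hF : E.MapsCoinv F) (ν ν' : C →ₗ[k] E.coinv) :
    E.preR (E.twistF F ν ν') = E.inclC ∘ₗ twistR (E.RF F hF) (E.coact ν) (E.coact ν') := by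
  rw [preR_eq_totalRF_comp_lTensor, ← twistR_totalRF]
  exact (rTensor_comp_twistR (E.rTensor_val_comp_RF F hF) _ _).symm

lemma mapsCoinv_twistF {F : C ⊗[k] P →ₗ[k] P} (hF : E.MapsCoinv F) (ν ν' : C →ₗ[k] E.coinv) :
    E.MapsCoinv (E.twistF F ν ν') :=
  fun x => ⟨_, (LinearMap.congr_fun (E.preR_twistF F hF ν ν') x).symm⟩

lemma twistR_RF {F : C ⊗[k] P →ₗ[k] P} (hF : E.MapsCoinv F) (ν ν' : C →ₗ[k] E.coinv) :
    twistR (E.RF F hF) (E.coact ν) (E.coact ν') =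
      E.RF (E.twistF F ν ν') (E.mapsCoinv_twistF hF ν ν') := by
  rw [← LinearMap.cancel_left E.inclC_injective, inclC_comp_RF, preR_twistF]

variable {E}

lemma Compatible.compEntwining_comp_lTensor {ν : C →ₗ[k] E.coinv} (hν : E.Compatible ν) :
    compEntwining E.Ψ E.ΨC ∘ₗ (E.inclC ∘ₗ E.coact ν).lTensor C =
      (E.inclC ∘ₗ E.coact ν).rTensor C ∘ₗ E.ΨC := by
  have h_assoc := congrArg ((TensorProduct.assoc k P C C).symm.toLinearMap ∘ₗ ·) hν
  have h_rTensor : (TensorProduct.assoc k P C C).symm.toLinearMap ∘ₗ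
      (E.incl ∘ₗ ν).rTensor (C ⊗[k] C) ∘ₗ (TensorProduct.assoc k C C C).toLinearMap =
        ((E.incl ∘ₗ ν).rTensor C).rTensor C := by
    ext
    simp
  rw [inclC_comp_coact, colift, LinearMap.lTensor_comp,
    LinearMap.rTensor_comp C ((E.incl ∘ₗ ν).rTensor C), ← h_rTensor]
  exact h_assoc

lemma Compatible.isColinear_twistSigma {ν : C →ₗ[k] E.coinv} (hν : E.Compatible ν)
    {F : C ⊗[k] P →ₗ[k] P} (hF : E.MapsCoinv F) (f : C ⊗[k] C →ₗ[k] E.coinv)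
    (ν' : C →ₗ[k] E.coinv) :
    IsColinear (twistedCoaction E.ΨC comul) (lTensorCoaction P comul)
      (E.inclC ∘ₗ twistSigma (E.RF F hF) (E.sigmaF f) (E.coact ν) (E.coact ν')) := by
  have h_twist : E.inclC ∘ₗ twistSigma (E.RF F hF) (E.sigmaF f) (E.coact ν) (E.coact ν') =
      twistSigma (E.totalRF F) (E.inclC ∘ₗ E.sigmaF f) (E.inclC ∘ₗ E.coact ν)
        (E.inclC ∘ₗ E.coact ν') :=
    rTensor_comp_twistSigma (E.rTensor_val_comp_RF F hF) _ _ _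
  rw [h_twist]
  exact (E.isColinear_totalRF F).twistSigma (E.isColinear_inclC.comp (E.isColinear_sigmaF f))
    (E.isColinear_inclC.comp (E.isColinear_coact ν))
    (E.isColinear_inclC.comp (E.isColinear_coact ν')) hν.compEntwining_comp_lTensor

lemma Compatible.twistSigma_sigmaF {ν : C →ₗ[k] E.coinv} (hν : E.Compatible ν)
    {F : C ⊗[k] P →ₗ[k] P} (hF : E.MapsCoinv F) (f : C ⊗[k] C →ₗ[k] E.coinv)
    (ν' : C →ₗ[k] E.coinv) :
    twistSigma (E.RF F hF) (E.sigmaF f) (E.coact ν) (E.coact ν') =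
      E.sigmaF (E.twistCocycle F hF f ν ν') := by
  have h_counit : lTensorCounit k C E.coinv ∘ₗ
      twistSigma (E.RF F hF) (E.sigmaF f) (E.coact ν) (E.coact ν') =
        E.twistCocycle F hF f ν ν' :=
    lTensorCounit_comp_twistSigma _ _ ν ν'
  rw [← LinearMap.cancel_left E.inclC_injective, (hν.isColinear_twistSigma hF f ν').eq_colift,
    ← LinearMap.comp_assoc, inclC, lTensorCounit_comp_rTensor, LinearMap.comp_assoc, h_counit,
    colift, LinearMap.rTensor_comp]
  rfl

lemma apply_e_of_toConv_mul_eq_one {ν ν' : C →ₗ[k] E.coinv}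
    (h : WithConv.toConv ν * WithConv.toConv ν' = 1) (he : ν E.e = 1) : ν' E.e = 1 := by
  have h_conv : LinearMap.mul' k E.coinv (TensorProduct.map ν ν' (comul (R := k) E.e)) =
      algebraMap k E.coinv (counit (R := k) E.e) :=
    LinearMap.congr_fun (congrArg WithConv.ofConv h) E.e
  simpa [E.groupLike.comul_eq_tmul_self, E.groupLike.counit_eq_one, he] using h_conv

lemma coact_e {ν : C →ₗ[k] E.coinv} (he : ν E.e = 1) : E.coact ν E.e = 1 ⊗ₜ E.e := by
  simp [coact, E.groupLike.comul_eq_tmul_self, he]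

end EntwiningData

end CrossedProd

end

theorem mainTheorem4 {k P C : Type*} [Field k] [Ring P] [Algebra k P] [AddCommGroup C]
    [Module k C] [Coalgebra k C] (E : CrossedProd.EntwiningData k P C)
    (F : C ⊗[k] P →ₗ[k] P) (f : C ⊗[k] C →ₗ[k] E.coinv) (h : E.IsCoalgCrossed F f)
    (ν ν' : C →ₗ[k] E.coinv)
    (hνν' : WithConv.toConv ν * WithConv.toConv ν' = 1)
    (hν'ν : WithConv.toConv ν' * WithConv.toConv ν = 1)
    (hνe : ν E.e = 1) (hν : E.Compatible ν) :
    CrossedProd.TwistConditions E.e (E.RF F h.mapsCoinv) (E.sigmaF f)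
        (E.coact ν) (E.coact ν') ∧
      CrossedProd.IsCrossed E.e
        (CrossedProd.twistR (E.RF F h.mapsCoinv) (E.coact ν) (E.coact ν'))
        (CrossedProd.twistSigma (E.RF F h.mapsCoinv) (E.sigmaF f) (E.coact ν) (E.coact ν')) ∧
      ∃ h' : E.IsCoalgCrossed (E.twistF F ν ν') (E.twistCocycle F h.mapsCoinv f ν ν'),
        CrossedProd.twistR (E.RF F h.mapsCoinv) (E.coact ν) (E.coact ν') =
            E.RF (E.twistF F ν ν') h'.mapsCoinv ∧
          CrossedProd.twistSigma (E.RF F h.mapsCoinv) (E.sigmaF f) (E.coact ν) (E.coact ν') =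
            E.sigmaF (E.twistCocycle F h.mapsCoinv f ν ν') ∧
          ∃ φ : CrossedProd.EntwiningData.CoalgCrossedProduct h' ≃ₐ[k]
              CrossedProd.EntwiningData.CoalgCrossedProduct h,
            ∀ (a : E.coinv) (c : C),
              φ (CrossedProd.CrossedProduct.of h'.isCrossed (a ⊗ₜ c)) =
                CrossedProd.CrossedProduct.of h.isCrossed
                  (CrossedProd.mulId k E.coinv C (a ⊗ₜ E.coact ν c)) := by
  have t := h.isCrossed.twistConditions (CrossedProd.EntwiningData.coact_e hνe)
    (CrossedProd.EntwiningData.coact_e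
      (CrossedProd.EntwiningData.apply_e_of_toConv_mul_eq_one hνν' hνe))
    (CrossedProd.extOne_colift hνν') (CrossedProd.extOne_colift hν'ν)
  have hcr := h.isCrossed.twist t
  have hR := E.twistR_RF h.mapsCoinv ν ν'
  have hσ := hν.twistSigma_sigmaF h.mapsCoinv f ν'
  have h' : E.IsCoalgCrossed (E.twistF F ν ν') (E.twistCocycle F h.mapsCoinv f ν ν') :=
    ⟨E.mapsCoinv_twistF h.mapsCoinv ν ν', by rwa [← hR, ← hσ]⟩
  exact ⟨t, hcr, h', hR, hσ, CrossedProd.twistEquiv h.isCrossed t h'.isCrossed hR hσ,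
    CrossedProd.twistEquiv_of_tmul h.isCrossed t h'.isCrossed hR hσ⟩
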